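/- **Theorem.** For each $I\ge 1$ consider a matched instrumental-variable study with $I$ matched sets. Set $i$ has $n_i$ units, of which $m_i$ have IV value $1$, with $\min\{m_i,n_i-m_i\}=1$. Unit $j$ of set $i$ has fixed real potential outcomes $Y_{ij}(1),Y_{ij}(0)$ and fixed real potential treatment values $D_{ij}(1),D_{ij}(0)$ under IV value $1$ and $0$, and a binary IV $Z_{ij}$; the observed values are $Y_{ij}=Z_{ij}Y_{ij}(1)+(1-Z_{ij})Y_{ij}(0)$ and $D_{ij}=Z_{ij}D_{ij}(1)+(1-Z_{ij})D_{ij}(0)$. (All these quantities may depend on $I$.) Let $\mathcal Z$ be the event that $\sum_{j}Z_{ij}=m_i$ for all $i$; it has positive probability. Let $\mathrm{pr}(\cdot\mid\mathcal Z)$, $E(\cdot\mid\mathcal Z)$, $\mathrm{var}(\cdot\mid\mathcal Z)$ refer to the law of the IV vector given the observed covariates $\mathbf X$, all the potential values, and $\mathcal Z$. Let $p_{ij}=\mathrm{pr}(Z_{ij}=1\mid\mathcal Z,\mathbf X)$ be the post-matching IV probabilities, and assume $0<p_{ij}<1$. Put $$\overline Y=\sum_{i=1}^I\sum_{j=1}^{n_i}\{Y_{ij}(1)-Y_{ij}(0)\},\qquad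 \overline D=\sum_{i=1}^I\sum_{j=1}^{n_i}\{D_{ij}(1)-D_{ij}(0)\},\qquad \theta=\overline Y/\overline D,$$ $$A_{*,i}(\theta_0)=\sum_{j=1}^{n_i}\frac{Z_{ij}}{p_{ij}}(Y_{ij}-\theta_0D_{ij})-\sum_{j=1}^{n_i}\frac{1-Z_{ij}}{1-p_{ij}}(Y_{ij}-\theta_0D_{ij}),\qquad A_*(\theta_0)=\frac1I\sum_{i=1}^IA_{*,i}(\theta_0),$$ $$V_*^2(\theta_0)=\frac1{I(I-1)}\sum_{i=1}^I\{A_{*,i}(\theta_0)-A_*(\theta_0)\}^2,$$ $$T_i=\sum_{j=1}^{n_i}\frac{Y_{ij}(Z_{ij}-p_{ij})}{p_{ij}(1-p_{ij})},\qquad S_i=\sum_{j=1}^{n_i}\frac{D_{ij}(Z_{ij}-p_{ij})}{p_{ij}(1-p_{ij})}.$$ Assume: * (independence) given $\mathcal Z$, the vectors $(Z_{i1},\dots,Z_{in_i})$, $i=1,\dots,I$, are independent; * (IV ignorability) given $\mathbf X$, the IV vector is independent of the potential outcomes and potential treatment values, that is, its law given $\mathbf X$ and all the potential values equals its law given $\mathbf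 X$; * (IV relevance) $\overline D>0$ for every $I\ge1$; * (S1) as $I\to\infty$, $I^{-1}\overline D$ converges to a positive finite limit and $I^{-1}\overline Y$ to a finite limit; * (S2) $E(T_i^2\mid\mathcal Z)<\infty$ and $E(S_i^2\mid\mathcal Z)<\infty$ for all $I$ and $i$, and $\sum_{i=1}^Ii^{-2}\mathrm{var}(T_i\mid\mathcal Z)$ and $\sum_{i=1}^Ii^{-2}\mathrm{var}(S_i\mid\mathcal Z)$ converge to finite limits as $I\to\infty$; * (S3) $\mathrm{var}\{A_*(\theta)\mid\mathcal Z\}>0$ for every $I\ge1$, and $\liminf_{I\to\infty}I\,\mathrm{var}\{A_*(\theta)\mid\mathcal Z\}>0$; * (S4) $\displaystyle\limsup_{I\to\infty}\frac{\sum_{i=1}^IE\{|A_{*,i}(\theta)-E\{A_{*,i}(\theta)\mid\mathcal Z\}|^3\mid\mathcal Z\}}{[\sum_{i=1}^I\mathrm{var}\{A_{*,i}(\theta)\mid\mathcal Z\}]^{3/2}}=0$; * (S5) $I^{-1}\sum_{i=1}^IE\{A_{*,i}^4(\theta)\mid\mathcal Z\}=o(I)$ as $I\to\infty$. For $\alpha\in(0,1/2)$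 let $CS^\theta_*$ be the set of all $\theta_0$ for which $V_*^2(\theta_0)>0$ and $|A_*(\theta_0)/\sqrt{V_*^2(\theta_0)}|\le\Phi^{-1}(1-\alpha/2)$, where $\Phi$ is the distribution function of $N(0,1)$. Then, for every $\alpha\in(0,1/2)$, $$\liminf_{I\to\infty}\mathrm{pr}(\theta\in CS^\theta_*\mid\mathcal Z)\ge1-\alpha .$$ -/

import Mathlib

open MeasureTheory ProbabilityTheory Filter Topology Asymptotics

noncomputable section

/-- A matched design with `I` matched sets: set `i` has `n i` units, of which `m i` have IV value 1
(encouraged), and either exactly one unit is encouraged or exactly one is not. -/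
structure MatchedDesign (I : ℕ) where
  n : Fin I → ℕ
  m : Fin I → ℕ
  min_eq_one : ∀ i, min (m i) (n i - m i) = 1

namespace MatchedDesign

variable {I : ℕ} (S : MatchedDesign I)

/-- IV assignments: one binary value for each unit `j` of each matched set `i`. -/
abbrev Assignment : Type := (i : Fin I) → Fin (S.n i) → Bool

/-- The set `𝒵` of the assignments with exactly `m i` encouraged units in each matched set `i`. -/
def feasible : Set S.Assignment :=
  {z | ∀ i, (Finset.univ.filter fun j => z i j = true).card = S.m i}

end MatchedDesign

/-- A matched instrumental-variable study with `I` matched sets. The covariates and the potential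
values are fixed; `Y1`, `Y0` (`D1`, `D0`) are the potential outcomes (treatment values) under IV
value 1 and 0. `lawX` is the law of the IV vector given the observed covariates, and `lawXR` its
law given the observed covariates and all the potential outcomes and treatment values. -/
structure MatchedIVStudy (I : ℕ) extends MatchedDesign I where
  Y1 : (i : Fin I) → Fin (n i) → ℝ
  Y0 : (i : Fin I) → Fin (n i) → ℝ
  D1 : (i : Fin I) → Fin (n i) → ℝ
  D0 : (i : Fin I) → Fin (n i) → ℝ
  lawX : Measure toMatchedDesign.Assignment
  lawXR : Measure toMatchedDesign.Assignment
  isProbabilityMeasure_lawX : IsProbabilityMeasure lawX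
  isProbabilityMeasure_lawXR : IsProbabilityMeasure lawXR
  lawX_feasible_pos : 0 < lawX toMatchedDesign.feasible
  lawXR_feasible_pos : 0 < lawXR toMatchedDesign.feasible

namespace MatchedIVStudy

variable {I : ℕ} (S : MatchedIVStudy I)

/-- The randomization law `pr(· ∣ 𝒵)`: all potential values are fixed, and one conditions on the
matched structure `𝒵`. All probabilities and moments below are taken under this law. -/
def post : Measure S.Assignment := ProbabilityTheory.cond S.lawXR S.feasible

/-- The post-matching IV probability `p_ij = pr(Z_ij = 1 ∣ 𝒵, X)`. -/
def p (i : Fin I) (j : Fin (S.n i)) : ℝ :=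
  (ProbabilityTheory.cond S.lawX S.feasible).real {z | z i j = true}

/-- IV ignorability: given the observed covariates, the IV is independent of the potential
outcomes and of the potential treatment values. -/
def Ignorability : Prop := S.lawXR = S.lawX

/-- All post-matching IV probabilities lie strictly between 0 and 1, so that the weights exist. -/
def Overlap : Prop := ∀ i j, 0 < S.p i j ∧ S.p i j < 1

/-- Independence of the IV assignments across matched sets, given `𝒵`. -/
def IndependentSets : Prop :=
  iIndepFun (fun (i : Fin I) (z : S.Assignment) => z i) S.post

/-- The IV indicator `Z_ij` as a real number. -/
def Z (z : S.Assignment) (i : Fin I) (j : Fin (S.n i)) : ℝ := if z i j = true then 1 else 0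

/-- The observed outcome. -/
def Y (z : S.Assignment) (i : Fin I) (j : Fin (S.n i)) : ℝ :=
  S.Z z i j * S.Y1 i j + (1 - S.Z z i j) * S.Y0 i j

/-- The observed treatment value. -/
def D (z : S.Assignment) (i : Fin I) (j : Fin (S.n i)) : ℝ :=
  S.Z z i j * S.D1 i j + (1 - S.Z z i j) * S.D0 i j

/-- The total effect of the IV on the outcome. -/
def totalY : ℝ := ∑ i, ∑ j, (S.Y1 i j - S.Y0 i j)

/-- The total effect of the IV on the treatment. -/
def totalD : ℝ := ∑ i, ∑ j, (S.D1 i j - S.D0 i j)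

/-- IV relevance. -/
def Relevance : Prop := 0 < S.totalD

/-- The effect ratio. -/
def effectRatio : ℝ := S.totalY / S.totalD

/-- The contribution of matched set `i` to the bias-corrected test statistic at `θ₀`. -/
def setStat (θ₀ : ℝ) (i : Fin I) (z : S.Assignment) : ℝ :=
  ∑ j, S.Z z i j / S.p i j * (S.Y z i j - θ₀ * S.D z i j)
    - ∑ j, (1 - S.Z z i j) / (1 - S.p i j) * (S.Y z i j - θ₀ * S.D z i j)

/-- The bias-corrected test statistic `A_*(θ₀)`. -/
def testStat (θ₀ : ℝ) (z : S.Assignment) : ℝ := (1 / (I : ℝ)) * ∑ i, S.setStat θ₀ i z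

/-- The variance estimator `V_*²(θ₀)`. -/
def varEst (θ₀ : ℝ) (z : S.Assignment) : ℝ :=
  1 / ((I : ℝ) * ((I : ℝ) - 1)) * ∑ i, (S.setStat θ₀ i z - S.testStat θ₀ z) ^ 2

/-- `T_i`. -/
def T (i : Fin I) (z : S.Assignment) : ℝ :=
  ∑ j, 1 / (S.p i j * (1 - S.p i j)) * S.Y z i j * (S.Z z i j - S.p i j)

/-- `S_i`. -/
def SD (i : Fin I) (z : S.Assignment) : ℝ :=
  ∑ j, 1 / (S.p i j * (1 - S.p i j)) * S.D z i j * (S.Z z i j - S.p i j)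

end MatchedIVStudy

/-- The quantile function `Φ⁻¹` of the standard normal distribution, on `(0, 1)`. -/
def stdNormalQuantile (q : ℝ) : ℝ := sInf {t : ℝ | q ≤ cdf (gaussianReal 0 1) t}

/-- The confidence set for the effect ratio. The ratio has to be defined: a value `θ₀` at which the
variance estimator vanishes does not belong to the set. -/
def MatchedIVStudy.confidenceSet {I : ℕ} (S : MatchedIVStudy I) (α : ℝ) (z : S.Assignment) :
    Set ℝ :=
  {θ₀ | 0 < S.varEst θ₀ z ∧
    |S.testStat θ₀ z / Real.sqrt (S.varEst θ₀ z)| ≤ stdNormalQuantile (1 - α / 2)}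

/-! Regularity conditions on a sequence of studies, the `I`-th one with `I` matched sets. -/

/-- Convergence of finite-population means. -/
structure ConvergentMeans (S : (I : ℕ) → MatchedIVStudy I) : Prop where
  treatment : ∃ d : ℝ, 0 < d ∧ Tendsto (fun I : ℕ => (1 / (I : ℝ)) * (S I).totalD) atTop (𝓝 d)
  outcome : ∃ y : ℝ, Tendsto (fun I : ℕ => (1 / (I : ℝ)) * (S I).totalY) atTop (𝓝 y)

/-- No extreme second moments or variances. (The index `i : Fin I` starts at 0.) -/
structure NoExtremeVariances (S : (I : ℕ) → MatchedIVStudy I) : Prop where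
  sq_T : ∀ (I : ℕ) (i : Fin I), Integrable (fun z => (S I).T i z ^ 2) (S I).post
  sq_SD : ∀ (I : ℕ) (i : Fin I), Integrable (fun z => (S I).SD i z ^ 2) (S I).post
  sum_T : ∃ t : ℝ, Tendsto (fun I : ℕ =>
    ∑ i : Fin I, variance ((S I).T i) (S I).post / ((i : ℝ) + 1) ^ 2) atTop (𝓝 t)
  sum_SD : ∃ s : ℝ, Tendsto (fun I : ℕ =>
    ∑ i : Fin I, variance ((S I).SD i) (S I).post / ((i : ℝ) + 1) ^ 2) atTop (𝓝 s)

/-- Non-degenerate test statistics: the variance of `A_*(θ)` is positive for every `I`, and the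
lower limit of `I` times this variance (the variance of `√I A_*(θ)`) is positive. -/
structure NonDegenerate (S : (I : ℕ) → MatchedIVStudy I) : Prop where
  pos : ∀ I : ℕ, 1 ≤ I → 0 < variance ((S I).testStat (S I).effectRatio) (S I).post
  liminf_pos : ∃ c : ℝ, 0 < c ∧ ∀ᶠ I : ℕ in atTop,
    c ≤ (I : ℝ) * variance ((S I).testStat (S I).effectRatio) (S I).post

/-- No extreme third moments. (The ratio is nonnegative, so that its upper limit is 0 exactly
if it tends to 0.) -/
def NoExtremeThirdMoments (S : (I : ℕ) → MatchedIVStudy I) : Prop :=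
  Tendsto (fun I : ℕ =>
    (∑ i : Fin I, ∫ z, |(S I).setStat (S I).effectRatio i z
        - ∫ z', (S I).setStat (S I).effectRatio i z' ∂(S I).post| ^ 3 ∂(S I).post)
      / (∑ i : Fin I, variance ((S I).setStat (S I).effectRatio i) (S I).post) ^ (3 / 2 : ℝ))
    atTop (𝓝 0)

/-- No extreme fourth moments. -/
def NoExtremeFourthMoments (S : (I : ℕ) → MatchedIVStudy I) : Prop :=
  (fun I : ℕ => (1 / (I : ℝ)) *
      ∑ i : Fin I, ∫ z, (S I).setStat (S I).effectRatio i z ^ 4 ∂(S I).post)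
    =o[atTop] (fun I : ℕ => (I : ℝ))

end

/-!
The bias-corrected statistic at the true effect ratio `θ` is a mean of independent contributions,
one for each matched set. By ignorability the weights are the true inverse assignment
probabilities, so the contribution of set `i` has mean
`∑ j, (Y1 i j - Y0 i j) - θ * ∑ j, (D1 i j - D0 i j)`, and these means sum to `totalY - θ totalD = 0`
(`MatchedIVStudy.sum_integral_setStat_effectRatio`). The individual means need not vanish and the
contributions are not identically distributed.

Normality. The third moment condition is Lyapunov's, so the statistic divided by its true standard
deviation converges in distribution to the standard normal law
(`tendstoInDistribution_sum_of_lyapunov`). Writing `φ` for a characteristic function, each factor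
satisfies `|φ t - exp (-v t² / 2)| ≤ (|t|³ + t⁴) E|X|³` as soon as its variance `v` is at most `1`;
these errors add up over a product of factors in the unit disc, and Lévy's convergence theorem
concludes.

Variance. Up to the square of the sample mean, the variance estimator is the sum of the squared
contributions, whose expectation is at least the sum of the variances, with the squared means as
excess. By the fourth moment condition Chebyshev's inequality keeps this sum near its expectation
and Markov's inequality makes the sample mean negligible; as the scaled variance is bounded below,
the estimator falls below a fixed fraction `r² < 1` of the true variance with vanishing probability
(`measureReal_meanVarEst_lt_le`).

Hence the coverage probability is asymptotically at least the normal probability of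
`[-r q, r q]`, for every `r < 1`, where `q` is the quantile; letting `r` tend to `1` gives at least
the normal probability of `[-q, q]` (`gaussianReal_Icc_le_liminf_abs_div_sqrt_meanVarEst_le`), which
is at least `1 - α` (`one_sub_le_gaussianReal_Icc`).
-/

/-! ### Lyapunov's central limit theorem -/

lemma norm_prod_sub_prod_le_sum {ι : Type*} (s : Finset ι) (a b : ι → ℂ)
    (ha : ∀ i ∈ s, ‖a i‖ ≤ 1) (hb : ∀ i ∈ s, ‖b i‖ ≤ 1) :
    ‖∏ i ∈ s, a i - ∏ i ∈ s, b i‖ ≤ ∑ i ∈ s, ‖a i - b i‖ := by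
  classical
  induction s using Finset.induction with
  | empty => simp
  | insert j s hj ih =>
    rw [Finset.prod_insert hj, Finset.prod_insert hj, Finset.sum_insert hj]
    have ih' := ih (fun i hi => ha i (Finset.mem_insert_of_mem hi))
      (fun i hi => hb i (Finset.mem_insert_of_mem hi))
    have hprod : ‖∏ i ∈ s, b i‖ ≤ 1 := (Finset.norm_prod_le _ _).trans <|
      Finset.prod_le_one (fun _ _ => norm_nonneg _)
        fun i hi => hb i (Finset.mem_insert_of_mem hi)
    have haj := ha j (Finset.mem_insert_self _ _)
    calc ‖a j * ∏ i ∈ s, a i - b j * ∏ i ∈ s, b i‖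
        = ‖a j * (∏ i ∈ s, a i - ∏ i ∈ s, b i) + (a j - b j) * ∏ i ∈ s, b i‖ := by ring_nf
      _ ≤ ‖a j‖ * ‖∏ i ∈ s, a i - ∏ i ∈ s, b i‖ + ‖a j - b j‖ * ‖∏ i ∈ s, b i‖ := by
          grw [norm_add_le, norm_mul, norm_mul]
      _ ≤ 1 * (∑ i ∈ s, ‖a i - b i‖) + ‖a j - b j‖ * 1 := by gcongr
      _ = ‖a j - b j‖ + ∑ i ∈ s, ‖a i - b i‖ := by ring

lemma norm_cexp_mul_I_sub_taylor_two_le (x : ℝ) :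
    ‖Complex.exp (x * Complex.I) - (1 + x * Complex.I - x ^ 2 / 2)‖ ≤ |x| ^ 3 := by
  have hnorm : ‖(x : ℂ) * Complex.I‖ = |x| := by simp
  rcases le_total |x| 2 with h | h
  · have := Complex.exp_bound' (x := x * Complex.I) (n := 3) (by rw [hnorm]; norm_num; linarith)
    simp only [Finset.sum_range_succ, Finset.range_zero, Finset.sum_empty, hnorm, mul_pow,
      Complex.I_sq] at this
    norm_num [Nat.factorial] at this
    have h3 : 0 ≤ |x| ^ 3 := by positivity
    calc _ = ‖Complex.exp (x * Complex.I) - (1 + x * Complex.I + -(x : ℂ) ^ 2 / 2)‖ := by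
          ring_nf
      _ ≤ _ := this.trans (by linarith)
  · have h1 : ‖(1 : ℂ) + x * Complex.I - x ^ 2 / 2‖ ≤ 1 + |x| + |x| ^ 2 / 2 := by
      refine (norm_sub_le _ _).trans ?_
      refine add_le_add ((norm_add_le _ _).trans (by simp)) (by simp)
    calc _ ≤ 1 + (1 + |x| + |x| ^ 2 / 2) := by
          refine (norm_sub_le _ _).trans (add_le_add (by simp [Complex.norm_exp]) h1)
      _ ≤ |x| ^ 3 := by
          nlinarith [mul_nonneg (sub_nonneg.2 h) (sq_nonneg |x|), sq_nonneg (|x| - 2)]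

lemma abs_exp_neg_sub_one_sub_le {u : ℝ} (hu : 0 ≤ u) : |Real.exp (-u) - (1 - u)| ≤ u ^ 2 := by
  have h1 := Real.add_one_le_exp (-u)
  have h2 : Real.exp (-u) ≤ 1 / (1 + u) := by
    rw [Real.exp_neg, ← one_div]
    exact one_div_le_one_div_of_le (by linarith) (by linarith [Real.add_one_le_exp u])
  have h3 : 1 / (1 + u) ≤ 1 - u + u ^ 2 := by
    rw [div_le_iff₀ (by linarith)]
    nlinarith [pow_nonneg hu 3]
  rw [abs_le]
  constructor <;> linarith [sq_nonneg u]

section CLT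

variable {Ω : Type*} [MeasurableSpace Ω] {P : Measure Ω} [IsProbabilityMeasure P]

/-- A bound `v ≤ 1` on the variance lets the error of replacing `1 - v t²/2` by the Gaussian
factor, which is of order `v²`, be absorbed into the third absolute moment. -/
lemma sq_integral_sq_le_integral_abs_cube {X : Ω → ℝ} (hX : MemLp X 3 P)
    (h1 : ∫ ω, X ω ^ 2 ∂P ≤ 1) :
    (∫ ω, X ω ^ 2 ∂P) ^ 2 ≤ ∫ ω, |X ω| ^ 3 ∂P := by
  set v := ∫ ω, X ω ^ 2 ∂P with hv
  have hv0 : 0 ≤ v := integral_nonneg fun _ => sq_nonneg _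
  have i2 : Integrable (fun ω => X ω ^ 2) P :=
    (hX.mono_exponent (p := 2) (by norm_num)).integrable_sq
  have i3 : Integrable (fun ω => |X ω| ^ 3) P := by
    simpa using hX.integrable_norm_pow (p := 3) (by norm_num)
  have key : ∫ ω, (3 * v * X ω ^ 2 - v ^ 3) ∂P ≤ ∫ ω, 2 * |X ω| ^ 3 ∂P := by
    refine integral_mono ((i2.const_mul _).sub (integrable_const _)) (i3.const_mul _) fun ω => ?_
    -- `2 a³ + v³ - 3 a² v = (a - v)² (2 a + v)` with `a = |X ω|`
    have ha := abs_nonneg (X ω)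
    rw [← sq_abs (X ω)]
    nlinarith [mul_nonneg (sq_nonneg (|X ω| - v)) (by positivity : 0 ≤ 2 * |X ω| + v)]
  rw [integral_sub (i2.const_mul _) (integrable_const _), integral_const_mul,
    integral_const_mul, ← hv] at key
  simp at key
  nlinarith [mul_nonneg (sq_nonneg v) (sub_nonneg.2 h1)]

lemma norm_charFun_sub_exp_le {X : Ω → ℝ} (hX : MemLp X 3 P) (h0 : ∫ ω, X ω ∂P = 0)
    (h1 : ∫ ω, X ω ^ 2 ∂P ≤ 1) (t : ℝ) :
    ‖charFun (P.map X) t - Complex.exp (-(∫ ω, X ω ^ 2 ∂P) * t ^ 2 / 2)‖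
      ≤ (|t| ^ 3 + t ^ 4) * ∫ ω, |X ω| ^ 3 ∂P := by
  set v := ∫ ω, X ω ^ 2 ∂P with hv
  have hv0 : 0 ≤ v := integral_nonneg fun _ => sq_nonneg _
  have hm := hX.aestronglyMeasurable.aemeasurable
  have i1 : Integrable X P := hX.integrable (by norm_num)
  have i2 : Integrable (fun ω => X ω ^ 2) P :=
    (hX.mono_exponent (p := 2) (by norm_num)).integrable_sq
  have i3 : Integrable (fun ω => |X ω| ^ 3) P := by
    simpa using hX.integrable_norm_pow (p := 3) (by norm_num)
  have hchar : charFun (P.map X) t = ∫ ω, Complex.exp ((t * X ω : ℝ) * Complex.I) ∂P := by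
    rw [charFun_apply_real, integral_map hm (by fun_prop)]
    simp
  have iexp : Integrable (fun ω => Complex.exp ((t * X ω : ℝ) * Complex.I)) P := by
    refine (integrable_const (1 : ℝ)).mono' (by fun_prop) (ae_of_all _ fun ω => ?_)
    rw [Complex.norm_exp_ofReal_mul_I]
  have j1 : Integrable (fun ω => ((t * X ω : ℝ) : ℂ) * Complex.I) P :=
    ((i1.const_mul t).ofReal).mul_const _
  have j2 : Integrable (fun ω => (((t * X ω : ℝ) : ℂ)) ^ 2 / 2) P := by
    have : Integrable (fun ω => (((t ^ 2 / 2 * X ω ^ 2 : ℝ) : ℂ))) P := (i2.const_mul _).ofReal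
    refine this.congr (ae_of_all _ fun ω => ?_)
    simp only []
    push_cast
    ring
  have j01 : Integrable (fun ω => 1 + ((t * X ω : ℝ) : ℂ) * Complex.I) P :=
    (integrable_const _).add j1
  have j012 : Integrable
      (fun ω => 1 + ((t * X ω : ℝ) : ℂ) * Complex.I - (((t * X ω : ℝ) : ℂ)) ^ 2 / 2) P :=
    j01.sub j2
  have hpoly : ∫ ω, (1 + ((t * X ω : ℝ) : ℂ) * Complex.I - (((t * X ω : ℝ) : ℂ)) ^ 2 / 2) ∂P
      = ((1 - v * t ^ 2 / 2 : ℝ) : ℂ) := by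
    rw [integral_sub j01 j2, integral_add (integrable_const _) j1]
    have e1 : ∫ ω, ((t * X ω : ℝ) : ℂ) * Complex.I ∂P = 0 := by
      rw [integral_mul_const, integral_complex_ofReal, integral_const_mul, h0]
      simp
    have e2 : ∫ ω, (((t * X ω : ℝ) : ℂ)) ^ 2 / 2 ∂P = ((v * t ^ 2 / 2 : ℝ) : ℂ) := by
      have : ∀ ω, (((t * X ω : ℝ) : ℂ)) ^ 2 / 2 = ((t ^ 2 / 2 * X ω ^ 2 : ℝ) : ℂ) := by
        intro ω; push_cast; ring
      simp_rw [this]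
      rw [integral_complex_ofReal, integral_const_mul, ← hv]
      congr 1
      ring
    rw [e1, e2]
    simp
  have step1 : ‖charFun (P.map X) t - ((1 - v * t ^ 2 / 2 : ℝ) : ℂ)‖
      ≤ |t| ^ 3 * ∫ ω, |X ω| ^ 3 ∂P := by
    rw [hchar, ← hpoly, ← integral_sub iexp j012,
      ← integral_const_mul]
    refine norm_integral_le_of_norm_le (i3.const_mul _) (ae_of_all _ fun ω => ?_)
    have := norm_cexp_mul_I_sub_taylor_two_le (t * X ω)
    rwa [abs_mul, mul_pow] at this
  have step2 : ‖((1 - v * t ^ 2 / 2 : ℝ) : ℂ) - Complex.exp (-v * t ^ 2 / 2)‖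
      ≤ t ^ 4 * ∫ ω, |X ω| ^ 3 ∂P := by
    have h := abs_exp_neg_sub_one_sub_le (u := v * t ^ 2 / 2) (by positivity)
    have hcast : ((1 - v * t ^ 2 / 2 : ℝ) : ℂ) - Complex.exp (-v * t ^ 2 / 2)
        = ((1 - v * t ^ 2 / 2 - Real.exp (-(v * t ^ 2 / 2)) : ℝ) : ℂ) := by
      push_cast; congr 2; ring
    rw [hcast, Complex.norm_real, Real.norm_eq_abs, abs_sub_comm]
    have hsq := sq_integral_sq_le_integral_abs_cube hX h1
    rw [← hv] at hsq
    have ht : 0 ≤ t ^ 4 := by positivity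
    calc _ ≤ (v * t ^ 2 / 2) ^ 2 := h
      _ = t ^ 4 * v ^ 2 / 4 := by ring
      _ ≤ t ^ 4 * v ^ 2 := by linarith [mul_nonneg ht (sq_nonneg v)]
      _ ≤ _ := by gcongr
  calc _ ≤ _ := norm_sub_le_norm_sub_add_norm_sub _ ((1 - v * t ^ 2 / 2 : ℝ) : ℂ) _
    _ ≤ |t| ^ 3 * ∫ ω, |X ω| ^ 3 ∂P + t ^ 4 * ∫ ω, |X ω| ^ 3 ∂P := add_le_add step1 step2
    _ = _ := by ring

/-- The quantitative form of Lyapunov's theorem, at the level of characteristic functions. -/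
lemma norm_charFun_sum_sub_exp_le {ι : Type*} [Fintype ι] {X : ι → Ω → ℝ}
    (hX : ∀ i, MemLp (X i) 3 P) (hindep : iIndepFun X P) (h0 : ∀ i, ∫ ω, X i ω ∂P = 0)
    (h1 : ∑ i, ∫ ω, X i ω ^ 2 ∂P = 1) (t : ℝ) :
    ‖charFun (P.map fun ω => ∑ i, X i ω) t - Complex.exp (-t ^ 2 / 2)‖
      ≤ (|t| ^ 3 + t ^ 4) * ∑ i, ∫ ω, |X i ω| ^ 3 ∂P := by
  have hv0 : ∀ i, 0 ≤ ∫ ω, X i ω ^ 2 ∂P := fun i => integral_nonneg fun _ => sq_nonneg _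
  have hv1 : ∀ i, ∫ ω, X i ω ^ 2 ∂P ≤ 1 := fun i =>
    h1 ▸ Finset.single_le_sum (fun i _ => hv0 i) (Finset.mem_univ i)
  have hm : ∀ i, AEMeasurable (X i) P := fun i => (hX i).aestronglyMeasurable.aemeasurable
  have hprob : ∀ i, IsProbabilityMeasure (P.map (X i)) :=
    fun i => Measure.isProbabilityMeasure_map (hm i)
  have hexp : Complex.exp (-t ^ 2 / 2)
      = ∏ i, Complex.exp (-((∫ ω, X i ω ^ 2 ∂P : ℝ) : ℂ) * t ^ 2 / 2) := by
    rw [← Complex.exp_sum]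
    congr 1
    have : ∑ i, ((∫ ω, X i ω ^ 2 ∂P : ℝ) : ℂ) = 1 := by exact_mod_cast h1
    rw [← Finset.sum_div, ← Finset.sum_mul, Finset.sum_neg_distrib, this]
    ring
  rw [hindep.charFun_map_fun_sum_eq_prod hm, Finset.prod_apply, hexp, Finset.mul_sum]
  refine (norm_prod_sub_prod_le_sum _ _ _ (fun i _ => norm_charFun_le_one _) fun i _ => ?_).trans
    (Finset.sum_le_sum fun i _ => norm_charFun_sub_exp_le (hX i) (h0 i) (hv1 i) t)
  rw [show -((∫ ω, X i ω ^ 2 ∂P : ℝ) : ℂ) * t ^ 2 / 2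
    = ((-((∫ ω, X i ω ^ 2 ∂P) * t ^ 2 / 2) : ℝ) : ℂ) by push_cast; ring, Complex.norm_exp_ofReal]
  refine Real.exp_le_one_iff.2 (neg_nonpos.2 ?_)
  have := hv0 i
  positivity

end CLT

/-- **Lyapunov's central limit theorem** for triangular arrays with normalized row variances. The
rows may live on different probability spaces. -/
theorem tendstoInDistribution_sum_of_lyapunov {Ω : ℕ → Type*} [∀ n, MeasurableSpace (Ω n)]
    (P : ∀ n, Measure (Ω n)) [∀ n, IsProbabilityMeasure (P n)]
    {ι : ℕ → Type*} [∀ n, Fintype (ι n)] {X : ∀ n, ι n → Ω n → ℝ}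
    (hX : ∀ n i, MemLp (X n i) 3 (P n)) (hindep : ∀ n, iIndepFun (X n) (P n))
    (h0 : ∀ n i, ∫ ω, X n i ω ∂(P n) = 0)
    (h1 : ∀ᶠ n in atTop, ∑ i, ∫ ω, X n i ω ^ 2 ∂(P n) = 1)
    (h3 : Tendsto (fun n => ∑ i, ∫ ω, |X n i ω| ^ 3 ∂(P n)) atTop (𝓝 0)) :
    TendstoInDistribution (fun n ω => ∑ i, X n i ω) atTop id P (gaussianReal 0 1) where
  forall_aemeasurable n :=
    Finset.aemeasurable_fun_sum _ fun i _ => (hX n i).aestronglyMeasurable.aemeasurable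
  tendsto := by
    refine ProbabilityMeasure.tendsto_iff_tendsto_charFun.2 fun t => ?_
    have hlim : charFun ((gaussianReal 0 1).map id) t = Complex.exp (-t ^ 2 / 2) := by
      rw [Measure.map_id, charFun_gaussianReal]
      simp [neg_div]
    simp only [ProbabilityMeasure.coe_mk, hlim]
    rw [tendsto_iff_norm_sub_tendsto_zero]
    refine squeeze_zero' (.of_forall fun _ => norm_nonneg _)
      (h1.mono fun n hn => norm_charFun_sum_sub_exp_le (hX n) (hindep n) (h0 n) hn t) ?_
    simpa using h3.const_mul (|t| ^ 3 + t ^ 4)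

/-! ### Central intervals of the standard normal distribution -/

lemma gaussianReal_neg_preimage (s : Set ℝ) (hs : MeasurableSet s) :
    gaussianReal 0 1 ((fun x => -x) ⁻¹' s) = gaussianReal 0 1 s := by
  rw [← Measure.map_apply measurable_neg hs, gaussianReal_map_neg, neg_zero]

lemma le_cdf_stdNormalQuantile {p : ℝ} (hp1 : p < 1) :
    p ≤ cdf (gaussianReal 0 1) (stdNormalQuantile p) := by
  set F := cdf (gaussianReal 0 1)
  set q := stdNormalQuantile p with hq
  have hne : {t : ℝ | p ≤ F t}.Nonempty :=
    (((tendsto_cdf_atTop (gaussianReal 0 1)).eventually_const_le hp1)).exists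
  -- every point to the right of the infimum lies in the set; the cdf is right-continuous
  have hright : ∀ᶠ t in 𝓝[>] q, p ≤ F t := by
    filter_upwards [self_mem_nhdsWithin] with t ht
    obtain ⟨u, hu, hut⟩ := exists_lt_of_csInf_lt hne ht
    exact hu.trans (F.mono hut.le)
  exact ge_of_tendsto ((F.right_continuous q).mono_left (nhdsWithin_mono _ Set.Ioi_subset_Ici_self))
    hright

lemma one_sub_le_gaussianReal_Icc {α : ℝ} (hα0 : 0 < α) :
    ENNReal.ofReal (1 - α) ≤ gaussianReal 0 1
      (Set.Icc (-stdNormalQuantile (1 - α / 2)) (stdNormalQuantile (1 - α / 2))) := by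
  set q := stdNormalQuantile (1 - α / 2)
  set G := gaussianReal 0 1
  have hF : 1 - α / 2 ≤ G.real (Set.Iic q) := by
    rw [← cdf_eq_real]
    exact le_cdf_stdNormalQuantile (by linarith)
  have hIoi : G.real (Set.Ioi q) ≤ α / 2 := by
    rw [← Set.compl_Iic, probReal_compl_eq_one_sub measurableSet_Iic]
    linarith
  have hIio : G.real (Set.Iio (-q)) ≤ α / 2 := by
    have : G.real (Set.Iio (-q)) = G.real (Set.Ioi q) := by
      rw [measureReal_def, measureReal_def, ← gaussianReal_neg_preimage _ measurableSet_Iio]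
      simp [G]
    rwa [this]
  have hcover : (Set.univ : Set ℝ) ⊆ Set.Iio (-q) ∪ Set.Ioi q ∪ Set.Icc (-q) q := fun x _ => by
    rcases lt_or_ge x (-q) with h | h
    · exact .inl (.inl h)
    · rcases lt_or_ge q x with h' | h'
      · exact .inl (.inr h')
      · exact .inr ⟨h, h'⟩
  have h1 : (1 : ℝ) ≤ G.real (Set.Iio (-q)) + G.real (Set.Ioi q) + G.real (Set.Icc (-q) q) :=
    calc (1 : ℝ) = G.real Set.univ := by simp
      _ ≤ _ := measureReal_mono hcover
      _ ≤ _ := (measureReal_union_le _ _).trans (by grw [measureReal_union_le])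
  rw [← ofReal_measureReal]
  exact ENNReal.ofReal_le_ofReal (by linarith)

lemma stdNormalQuantile_pos {α : ℝ} (hα0 : 0 < α) (hα1 : α < 1) :
    0 < stdNormalQuantile (1 - α / 2) := by
  by_contra! h
  have h1 := one_sub_le_gaussianReal_Icc hα0
  have : NullSingletonClass (gaussianReal 0 1) := nullSingletonClass_gaussianReal one_ne_zero
  have h2 : gaussianReal 0 1
      (Set.Icc (-stdNormalQuantile (1 - α / 2)) (stdNormalQuantile (1 - α / 2))) ≤ 0 := by
    refine (measure_mono (t := {0}) fun x hx => ?_).trans (measure_singleton _).le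
    have := hx.1
    have := hx.2
    simp only [Set.mem_singleton_iff]
    linarith
  rw [nonpos_iff_eq_zero.1 h2, nonpos_iff_eq_zero, ENNReal.ofReal_eq_zero] at h1
  linarith

/-- Inner approximation of a central interval, which absorbs the relative error of the variance
estimator. -/
lemma gaussianReal_Icc_le_of_forall_lt {q : ℝ} (hq : 0 < q) {L : ENNReal}
    (h : ∀ r, 0 < r → r < 1 → gaussianReal 0 1 (Set.Icc (-(r * q)) (r * q)) ≤ L) :
    gaussianReal 0 1 (Set.Icc (-q) q) ≤ L := by
  have : NullSingletonClass (gaussianReal 0 1) := nullSingletonClass_gaussianReal one_ne_zero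
  rw [← measure_congr (Ioo_ae_eq_Icc (μ := gaussianReal 0 1))]
  obtain ⟨u, humono, hu, hulim⟩ := exists_seq_strictMono_tendsto' (zero_lt_one (α := ℝ))
  have hsub : Set.Ioo (-q) q ⊆ ⋃ n, Set.Icc (-(u n * q)) (u n * q) := fun x hx => by
    have h1 : |x| / q < 1 := (div_lt_one hq).2 (abs_lt.2 hx)
    obtain ⟨n, hn⟩ := (hulim.eventually_const_lt h1).exists
    exact Set.mem_iUnion.2 ⟨n, abs_le.1 ((div_lt_iff₀ hq).1 hn).le⟩
  have hmono : Monotone fun n => Set.Icc (-(u n * q)) (u n * q) := fun m n hmn => by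
    have := mul_le_mul_of_nonneg_right (humono.monotone hmn) hq.le
    exact Set.Icc_subset_Icc (by linarith) this
  calc _ ≤ _ := measure_mono hsub
    _ = ⨆ n, _ := hmono.measure_iUnion
    _ ≤ L := iSup_le fun n => h _ (hu n).1 (hu n).2

/-! ### Self-normalized sums of independent, not identically distributed variables -/

noncomputable section

/-- The mean of a finite sample. -/
def sampleMean {n : ℕ} (w : Fin n → ℝ) : ℝ := (1 / (n : ℝ)) * ∑ i, w i

/-- The usual estimator `∑ (wᵢ - w̄)² / (n (n - 1))` of the variance of the sample mean. It is `0`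
for `n ≤ 1`. -/
def meanVarEst {n : ℕ} (w : Fin n → ℝ) : ℝ :=
  1 / ((n : ℝ) * ((n : ℝ) - 1)) * ∑ i, (w i - sampleMean w) ^ 2

end

lemma sum_sub_sampleMean_sq {n : ℕ} (hn : 0 < n) (w : Fin n → ℝ) :
    ∑ i, (w i - sampleMean w) ^ 2 = ∑ i, w i ^ 2 - n * sampleMean w ^ 2 := by
  have hn' : (n : ℝ) ≠ 0 := by positivity
  have hs : ∑ i, w i = n * sampleMean w := by
    rw [sampleMean]
    field_simp
  simp only [sub_sq, Finset.sum_add_distrib, Finset.sum_sub_distrib, ← Finset.sum_mul,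
    ← Finset.mul_sum, hs, Finset.sum_const, Finset.card_univ, Fintype.card_fin, nsmul_eq_mul]
  ring

lemma sum_sq_sub_le_sq_mul_meanVarEst {n : ℕ} (hn : 2 ≤ n) (w : Fin n → ℝ) :
    ∑ i, w i ^ 2 - n * sampleMean w ^ 2 ≤ (n : ℝ) ^ 2 * meanVarEst w := by
  have hn' : (2 : ℝ) ≤ n := by exact_mod_cast hn
  have h0 : 0 ≤ ∑ i, (w i - sampleMean w) ^ 2 := Finset.sum_nonneg fun _ _ => sq_nonneg _
  rw [meanVarEst, ← sum_sub_sampleMean_sq (by lia)]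
  have h1 : (n : ℝ) ^ 2 * (1 / (n * ((n : ℝ) - 1)) * ∑ i, (w i - sampleMean w) ^ 2)
      = n / (n - 1) * ∑ i, (w i - sampleMean w) ^ 2 := by
    have : (n : ℝ) - 1 ≠ 0 := by linarith
    field_simp
  rw [h1]
  refine le_mul_of_one_le_left h0 ?_
  rw [one_le_div (by linarith)]
  linarith

section Moments

variable {Ω : Type*} [MeasurableSpace Ω] {P : Measure Ω}

lemma MeasureTheory.MemLp.integrable_pow_four {X : Ω → ℝ} (hX : MemLp X 4 P) :
    Integrable (fun ω => X ω ^ 4) P := by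
  have := hX.integrable_norm_pow (p := 4) (by norm_num)
  refine this.congr (ae_of_all _ fun ω => ?_)
  simp [Even.pow_abs (by decide : Even 4)]

lemma MeasureTheory.MemLp.memLp_sq {X : Ω → ℝ} (hX : MemLp X 4 P) :
    MemLp (fun ω => X ω ^ 2) 2 P := by
  have hm := hX.aestronglyMeasurable
  rw [memLp_two_iff_integrable_sq (by fun_prop)]
  simpa [← pow_mul] using hX.integrable_pow_four

variable [IsProbabilityMeasure P] {n : ℕ} {W : Fin n → Ω → ℝ}

lemma integral_sq_sampleMean (hW : ∀ i, MemLp (W i) 2 P) (hindep : iIndepFun W P)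
    (hmean : ∑ i, ∫ ω, W i ω ∂P = 0) :
    ∫ ω, sampleMean (fun i => W i ω) ^ 2 ∂P = (∑ i, Var[W i; P]) / (n : ℝ) ^ 2 := by
  have hint : ∀ i, Integrable (W i) P := fun i => (hW i).integrable (by norm_num)
  have hvar := IndepFun.variance_sum (s := Finset.univ) (fun i _ => hW i)
    (fun i _ j _ hij => hindep.indepFun hij)
  rw [variance_of_integral_eq_zero] at hvar
  · simp only [Finset.sum_apply] at hvar
    rw [← hvar, ← integral_div]
    congr 1 with ω
    rw [sampleMean]
    ring
  · exact Finset.aemeasurable_sum _ fun i _ => (hW i).aestronglyMeasurable.aemeasurable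
  · simp only [Finset.sum_apply]
    rw [integral_finsetSum _ fun i _ => hint i, hmean]

lemma sum_variance_le_card_add_sum_pow_four (hW : ∀ i, MemLp (W i) 4 P) :
    ∑ i, Var[W i; P] ≤ n + ∑ i, ∫ ω, W i ω ^ 4 ∂P := by
  calc ∑ i, Var[W i; P] ≤ ∑ i, (1 + ∫ ω, W i ω ^ 4 ∂P) := Finset.sum_le_sum fun i _ => by
        have i4 := (hW i).integrable_pow_four
        have i2 : Integrable (fun ω => W i ω ^ 2) P :=
          ((hW i).mono_exponent (p := 2) (by norm_num)).integrable_sq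
        calc Var[W i; P] ≤ ∫ ω, W i ω ^ 2 ∂P :=
              variance_le_expectation_sq (hW i).aestronglyMeasurable
          _ ≤ ∫ ω, (1 + W i ω ^ 4) ∂P := by
              refine integral_mono i2 ((integrable_const _).add i4) fun ω => ?_
              nlinarith [sq_nonneg (W i ω ^ 2 - 1), sq_nonneg (W i ω ^ 2)]
          _ = 1 + ∫ ω, W i ω ^ 4 ∂P := by
              rw [integral_add (integrable_const _) i4]
              simp
    _ = _ := by simp [Finset.sum_add_distrib]

lemma variance_sum_sq_le (hW : ∀ i, MemLp (W i) 4 P) (hindep : iIndepFun W P) :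
    Var[fun ω => ∑ i, W i ω ^ 2; P] ≤ ∑ i, ∫ ω, W i ω ^ 4 ∂P := by
  have hindep2 : iIndepFun (fun i ω => W i ω ^ 2) P :=
    hindep.comp (fun _ x => x ^ 2) fun _ => by fun_prop
  have hvar := IndepFun.variance_sum (s := Finset.univ) (fun i _ => (hW i).memLp_sq)
    (fun i _ j _ hij => hindep2.indepFun hij)
  have heq : (fun ω => ∑ i, W i ω ^ 2) = ∑ i, fun ω => W i ω ^ 2 := by
    ext ω
    simp
  rw [heq, hvar]
  refine Finset.sum_le_sum fun i _ => ?_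
  refine (variance_le_expectation_sq (hW i).memLp_sq.aestronglyMeasurable).trans_eq ?_
  congr 1 with ω
  simp [← pow_mul]

/-- The variance estimator underestimates the variance of the sample mean with small probability
only. If it does, then either `∑ Wᵢ²` falls short of its mean, which is at least `∑ var Wᵢ`, or the
sample mean is large; Chebyshev's inequality bounds the first event, Markov's the second. The
summands need not have equal means: this only makes the estimator more conservative. -/
lemma measureReal_meanVarEst_lt_le (hn : 2 ≤ n) (hW : ∀ i, MemLp (W i) 4 P)
    (hindep : iIndepFun W P) (hmean : ∑ i, ∫ ω, W i ω ∂P = 0) {c r : ℝ} (hc : 0 < c)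
    (hcn : c * n ≤ ∑ i, Var[W i; P]) (hr : r < 1) :
    P.real {ω | (n : ℝ) ^ 2 * meanVarEst (fun i => W i ω) < r * ∑ i, Var[W i; P]} ≤
      (∑ i, ∫ ω, W i ω ^ 4 ∂P) / (n : ℝ) ^ 2 / ((1 - r) * c / 2) ^ 2
        + (1 / n + (∑ i, ∫ ω, W i ω ^ 4 ∂P) / (n : ℝ) ^ 2) / ((1 - r) * c / 2) := by
  set δ := (1 - r) * c / 2 with hδ
  have hδ0 : 0 < δ := by
    have : 0 < 1 - r := by linarith
    positivity
  have hn0 : (0 : ℝ) < n := by positivity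
  set s := ∑ i, Var[W i; P] with hs
  have hW2 : ∀ i, MemLp (W i) 2 P := fun i => (hW i).mono_exponent (by norm_num)
  set Q : Ω → ℝ := fun ω => ∑ i, W i ω ^ 2 with hQ
  have hQ2 : MemLp Q 2 P := memLp_finsetSum _ fun i _ => (hW i).memLp_sq
  have hsQ : s ≤ ∫ ω, Q ω ∂P := by
    rw [hQ, integral_finsetSum _ fun i _ => (hW2 i).integrable_sq]
    exact Finset.sum_le_sum fun i _ => variance_le_expectation_sq (hW i).aestronglyMeasurable
  have hA2 : Integrable (fun ω => sampleMean (fun i => W i ω) ^ 2) P :=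
    ((memLp_finsetSum _ fun i _ => hW2 i).const_mul (1 / (n : ℝ))).integrable_sq
  have hQdev : MemLp (fun ω => Q ω - ∫ ω', Q ω' ∂P) 2 P := hQ2.sub (memLp_const _)
  have hsub : {ω | (n : ℝ) ^ 2 * meanVarEst (fun i => W i ω) < r * s} ⊆
      {ω | (δ * n) ^ 2 ≤ (Q ω - ∫ ω', Q ω' ∂P) ^ 2}
        ∪ {ω | δ ≤ sampleMean (fun i => W i ω) ^ 2} := fun ω hω => by
    by_contra hcon
    simp only [Set.mem_union, Set.mem_ofPred_eq, not_or, not_le] at hcon hω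
    have h1 := (abs_lt_of_sq_lt_sq hcon.1 (by positivity))
    have h2 := sum_sq_sub_le_sq_mul_meanVarEst hn fun i => W i ω
    have h3 := mul_lt_mul_of_pos_left hcon.2 hn0
    have h4 : (1 - r) * (c * n) ≤ (1 - r) * s := by
      have : 0 ≤ 1 - r := by linarith
      gcongr
    have h5 : (1 - r) * (c * n) = 2 * (δ * n) := by rw [hδ]; ring
    have h6 := (abs_lt.1 h1).1
    have h7 : Q ω = ∑ i, W i ω ^ 2 := rfl
    linarith
  have hcheb : P.real {ω | (δ * n) ^ 2 ≤ (Q ω - ∫ ω', Q ω' ∂P) ^ 2}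
      ≤ (∑ i, ∫ ω, W i ω ^ 4 ∂P) / (n : ℝ) ^ 2 / δ ^ 2 := by
    have := mul_meas_ge_le_integral_of_nonneg (μ := P)
      (ae_of_all _ fun ω => sq_nonneg (Q ω - ∫ ω', Q ω' ∂P)) hQdev.integrable_sq ((δ * n) ^ 2)
    rw [← variance_eq_integral hQ2.aestronglyMeasurable.aemeasurable] at this
    rw [div_div, le_div_iff₀' (by positivity), ← mul_pow, mul_comm (n : ℝ)]
    exact this.trans (variance_sum_sq_le hW hindep)
  have hmarkov : P.real {ω | δ ≤ sampleMean (fun i => W i ω) ^ 2}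
      ≤ (1 / n + (∑ i, ∫ ω, W i ω ^ 4 ∂P) / (n : ℝ) ^ 2) / δ := by
    have := mul_meas_ge_le_integral_of_nonneg (μ := P)
      (ae_of_all _ fun ω => sq_nonneg (sampleMean fun i => W i ω)) hA2 δ
    rw [integral_sq_sampleMean hW2 hindep hmean] at this
    rw [le_div_iff₀' hδ0]
    refine this.trans ((div_le_div_of_nonneg_right
      (sum_variance_le_card_add_sum_pow_four hW) (by positivity)).trans_eq ?_)
    field_simp
  calc _ ≤ _ := measureReal_mono hsub
    _ ≤ _ := measureReal_union_le _ _
    _ ≤ _ := add_le_add hcheb hmarkov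

end Moments

lemma sum_standardized_eq {n : ℕ} (w m : Fin n → ℝ) (hm : ∑ i, m i = 0) (s : ℝ) :
    ∑ i, (w i - m i) / s = n * sampleMean w / s := by
  rcases eq_or_ne n 0 with rfl | hn
  · simp
  have : (n : ℝ) ≠ 0 := by exact_mod_cast hn
  rw [← Finset.sum_div, Finset.sum_sub_distrib, hm, sub_zero, sampleMean]
  congr 1
  field_simp

lemma abs_div_sqrt_le_of_standardized_le {n : ℕ} (hn : 0 < n) {a v s q r : ℝ} (hs : 0 < s)
    (hr : 0 < r) (hq : 0 < q)
    (ha : |n * a / √s| ≤ r * q) (hv : r ^ 2 * s ≤ (n : ℝ) ^ 2 * v) :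
    0 < v ∧ |a / √v| ≤ q := by
  have hn' : (0 : ℝ) < n := by exact_mod_cast hn
  have hv0 : 0 < v := by
    have : 0 < (n : ℝ) ^ 2 * v := lt_of_lt_of_le (by positivity) hv
    exact (pos_iff_pos_of_mul_pos this).1 (by positivity)
  refine ⟨hv0, ?_⟩
  have hsv : r * √s ≤ n * √v := by
    have := Real.sqrt_le_sqrt hv
    rwa [Real.sqrt_mul (by positivity), Real.sqrt_mul (by positivity), Real.sqrt_sq hr.le,
      Real.sqrt_sq hn'.le] at this
  have hs' := Real.sqrt_pos.2 hs
  have hv' := Real.sqrt_pos.2 hv0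
  rw [abs_div, abs_of_pos hs', div_le_iff₀ hs', abs_mul, abs_of_pos hn'] at ha
  rw [abs_div, abs_of_pos hv', div_le_iff₀ hv']
  have : n * |a| ≤ n * (q * √v) := by nlinarith [mul_le_mul_of_nonneg_left hsv hq.le]
  exact le_of_mul_le_mul_left this hn'

/-- Coverage of the self-normalized sample mean in a triangular array: the limiting probability of
`|mean / √(variance estimate)| ≤ q` is at least the standard normal one. -/
theorem gaussianReal_Icc_le_liminf_abs_div_sqrt_meanVarEst_le {Ω : ℕ → Type*}
    [∀ n, MeasurableSpace (Ω n)] (P : ∀ n, Measure (Ω n)) [∀ n, IsProbabilityMeasure (P n)]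
    {W : ∀ n, Fin n → Ω n → ℝ} (hW : ∀ n i, MemLp (W n i) 4 (P n))
    (hindep : ∀ n, iIndepFun (W n) (P n))
    (hmean : ∀ᶠ n in atTop, ∑ i, ∫ ω, W n i ω ∂(P n) = 0) {c : ℝ} (hc : 0 < c)
    (hvar : ∀ᶠ n : ℕ in atTop, c * n ≤ ∑ i, Var[W n i; P n])
    (h3 : Tendsto (fun n => (∑ i, ∫ ω, |W n i ω - ∫ ω', W n i ω' ∂(P n)| ^ 3 ∂(P n))
      / (∑ i, Var[W n i; P n]) ^ (3 / 2 : ℝ)) atTop (𝓝 0))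
    (h4 : Tendsto (fun n : ℕ => (∑ i, ∫ ω, W n i ω ^ 4 ∂(P n)) / (n : ℝ) ^ 2) atTop (𝓝 0))
    {q : ℝ} (hq : 0 < q) :
    gaussianReal 0 1 (Set.Icc (-q) q) ≤ liminf (fun n => P n {ω |
      0 < meanVarEst (fun i => W n i ω) ∧
        |sampleMean (fun i => W n i ω) / √(meanVarEst fun i => W n i ω)| ≤ q}) atTop := by
  set s : ℕ → ℝ := fun n => ∑ i, Var[W n i; P n] with hs
  have hs0 : ∀ n, 0 ≤ s n := fun n => Finset.sum_nonneg fun i _ => variance_nonneg _ _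
  have hspos : ∀ᶠ n in atTop, 0 < s n := by
    filter_upwards [hvar, eventually_gt_atTop 0] with n hn hn0
    have : (0 : ℝ) < n := by exact_mod_cast hn0
    exact lt_of_lt_of_le (by positivity) hn
  have hint : ∀ n i, Integrable (W n i) (P n) := fun n i => (hW n i).integrable (by norm_num)
  have hclt : TendstoInDistribution
      (fun n ω => ∑ i, (W n i ω - ∫ ω', W n i ω' ∂(P n)) / √(s n)) atTop id P
      (gaussianReal 0 1) := by
    refine tendstoInDistribution_sum_of_lyapunov P
      (X := fun n i ω => (W n i ω - ∫ ω', W n i ω' ∂(P n)) / √(s n)) ?_ ?_ ?_ ?_ ?_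
    · intro n i
      simp_rw [div_eq_mul_inv]
      exact (((hW n i).mono_exponent (by norm_num)).sub (memLp_const _)).mul_const _
    · exact fun n => (hindep n).comp (fun i x => (x - ∫ ω', W n i ω' ∂(P n)) / √(s n))
        fun i => by fun_prop
    · intro n i
      rw [integral_div, integral_sub (hint n i) (integrable_const _)]
      simp
    · filter_upwards [hspos] with n hn
      have : ∀ i, ∫ ω, ((W n i ω - ∫ ω', W n i ω' ∂(P n)) / √(s n)) ^ 2 ∂(P n)
          = Var[W n i; P n] / s n := fun i => by
        simp_rw [div_pow, Real.sq_sqrt (hs0 n)]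
        rw [integral_div, variance_eq_integral (hW n i).aestronglyMeasurable.aemeasurable]
      simp_rw [this]
      rw [← Finset.sum_div]
      exact div_self hn.ne'
    · refine h3.congr fun n => ?_
      rw [Finset.sum_div]
      refine Finset.sum_congr rfl fun i _ => ?_
      rw [← integral_div]
      congr 1 with ω
      rw [abs_div, abs_of_nonneg (Real.sqrt_nonneg _), div_pow, Real.sqrt_eq_rpow,
        ← Real.rpow_natCast, ← Real.rpow_natCast (s n ^ (1 / 2 : ℝ)), ← Real.rpow_mul (hs0 n)]
      norm_num
      rfl
  have hmass : ∀ x : ℝ, Tendsto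
      (fun n => P n {ω | |n * sampleMean (fun i => W n i ω) / √(s n)| ≤ x}) atTop
      (𝓝 (gaussianReal 0 1 (Set.Icc (-x) x))) := fun x => by
    have : NullSingletonClass (gaussianReal 0 1) := nullSingletonClass_gaussianReal one_ne_zero
    have hfront : gaussianReal 0 1 (frontier (Set.Icc (-x) x)) = 0 := by
      refine measure_mono_null (t := {-x, x}) ?_ ((Set.toFinite _).measure_zero _)
      rcases le_or_gt (-x) x with h | h
      · rw [frontier_Icc h]
      · simp [Set.Icc_eq_empty_of_lt h]
    have hlim := ProbabilityMeasure.tendsto_measure_of_null_frontier_of_tendsto' hclt.tendsto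
      (E := Set.Icc (-x) x) (by simpa using hfront)
    simp only [ProbabilityMeasure.coe_mk, Measure.map_id] at hlim
    refine hlim.congr' ?_
    filter_upwards [hmean] with n hn
    rw [Measure.map_apply_of_aemeasurable (hclt.forall_aemeasurable n) measurableSet_Icc]
    congr 1 with ω
    simp only [Set.mem_preimage, Set.mem_ofPred_eq, Set.mem_Icc, abs_le,
      sum_standardized_eq (fun i => W n i ω) _ hn]
  refine gaussianReal_Icc_le_of_forall_lt hq fun r hr0 hr1 => ?_
  have hr2 : r ^ 2 < 1 := by nlinarith
  set δ := (1 - r ^ 2) * c / 2 with hδ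
  set b : ℕ → ℝ := fun n => (∑ i, ∫ ω, W n i ω ^ 4 ∂(P n)) / (n : ℝ) ^ 2 / δ ^ 2
        + (1 / n + (∑ i, ∫ ω, W n i ω ^ 4 ∂(P n)) / (n : ℝ) ^ 2) / δ with hb
  have hb0 : Tendsto (fun n => ENNReal.ofReal (b n)) atTop (𝓝 0) := by
    have : Tendsto b atTop (𝓝 (0 / δ ^ 2 + (0 + 0) / δ)) :=
      (h4.div_const _).add ((tendsto_one_div_atTop_nhds_zero_nat.add h4).div_const _)
    simpa using ENNReal.tendsto_ofReal this
  have hdiff := ENNReal.Tendsto.sub (hmass (r * q)) hb0 (.inr ENNReal.zero_ne_top)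
  rw [tsub_zero] at hdiff
  rw [← hdiff.liminf_eq]
  refine liminf_le_liminf ?_
  filter_upwards [hmean, hvar, hspos, eventually_ge_atTop 2] with n hmn hvn hsn hn
  rw [tsub_le_iff_right]
  have hbad := measureReal_meanVarEst_lt_le hn (hW n) (hindep n) hmn hc hvn hr2
  calc _ ≤ P n ({ω | 0 < meanVarEst (fun i => W n i ω) ∧
        |sampleMean (fun i => W n i ω) / √(meanVarEst fun i => W n i ω)| ≤ q} ∪
          {ω | (n : ℝ) ^ 2 * meanVarEst (fun i => W n i ω) < r ^ 2 * s n}) := by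
        refine measure_mono fun ω hω => ?_
        rcases lt_or_ge ((n : ℝ) ^ 2 * meanVarEst (fun i => W n i ω)) (r ^ 2 * s n) with h | h
        · exact .inr h
        · exact .inl (abs_div_sqrt_le_of_standardized_le (by lia) hsn hr0 hq hω h)
    _ ≤ _ := measure_union_le _ _
    _ ≤ _ := by
        gcongr
        rw [← ofReal_measureReal]
        exact ENNReal.ofReal_le_ofReal hbad

/-! ### Matched instrumental-variable studies -/

namespace MatchedIVStudy

variable {I : ℕ} (S : MatchedIVStudy I)

instance : IsProbabilityMeasure S.post :=
  have := S.isProbabilityMeasure_lawXR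
  cond_isProbabilityMeasure S.lawXR_feasible_pos.ne'

lemma memLp_post (f : S.Assignment → ℝ) (p : ENNReal) : MemLp f p S.post := by
  have : Finite S.Assignment := inferInstance
  refine MemLp.of_bound (measurable_of_countable f).aestronglyMeasurable (∑ᶠ z, ‖f z‖)
    (ae_of_all _ fun z => ?_)
  exact single_le_finsum z (Set.toFinite _) fun _ => norm_nonneg _

lemma integral_Z (hign : S.Ignorability) (i : Fin I) (j : Fin (S.n i)) :
    ∫ z, S.Z z i j ∂S.post = S.p i j := by
  have hmeas : MeasurableSet {z : S.Assignment | z i j = true} := Set.Finite.measurableSet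
    (Set.toFinite _)
  have : ∀ z, S.Z z i j = Set.indicator {z : S.Assignment | z i j = true} 1 z := fun z => by
    simp [Z, Set.indicator]
  simp_rw [this]
  rw [integral_indicator_one hmeas, p, post, hign]

/-- The observed values enter the statistic only through the arm that is actually seen. -/
lemma setStat_eq (θ : ℝ) (i : Fin I) (z : S.Assignment) :
    S.setStat θ i z = ∑ j, (S.Z z i j * ((S.Y1 i j - θ * S.D1 i j) / S.p i j)
      - (1 - S.Z z i j) * ((S.Y0 i j - θ * S.D0 i j) / (1 - S.p i j))) := by
  rw [setStat, ← Finset.sum_sub_distrib]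
  refine Finset.sum_congr rfl fun j _ => ?_
  by_cases h : z i j = true <;> simp [Z, Y, D, h, div_eq_inv_mul]

/-- Inverse probability weighting makes the contribution of each matched set unbiased. -/
lemma integral_setStat (hov : S.Overlap) (hign : S.Ignorability) (θ : ℝ) (i : Fin I) :
    ∫ z, S.setStat θ i z ∂S.post
      = ∑ j, (S.Y1 i j - S.Y0 i j) - θ * ∑ j, (S.D1 i j - S.D0 i j) := by
  have hint : ∀ f : S.Assignment → ℝ, Integrable f S.post := fun f =>
    (S.memLp_post f 1).integrable le_rfl
  simp_rw [setStat_eq]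
  rw [integral_finsetSum _ fun j _ => hint _, Finset.mul_sum, ← Finset.sum_sub_distrib]
  refine Finset.sum_congr rfl fun j _ => ?_
  rw [integral_sub (hint _) (hint _), integral_mul_const, integral_mul_const,
    integral_sub (hint _) (hint _), S.integral_Z hign]
  have h1 := (hov i j).1.ne'
  have h2 := (sub_pos.2 (hov i j).2).ne'
  simp only [integral_const, probReal_univ, smul_eq_mul, mul_one]
  field_simp
  ring

lemma sum_integral_setStat_effectRatio (hov : S.Overlap) (hign : S.Ignorability)
    (hrel : S.Relevance) : ∑ i, ∫ z, S.setStat S.effectRatio i z ∂S.post = 0 := by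
  simp_rw [S.integral_setStat hov hign]
  rw [Finset.sum_sub_distrib, ← Finset.mul_sum]
  change S.totalY - S.totalY / S.totalD * S.totalD = 0
  rw [div_mul_cancel₀ _ (ne_of_gt hrel), sub_self]

lemma iIndepFun_setStat (hind : S.IndependentSets) (θ : ℝ) :
    iIndepFun (S.setStat θ) S.post := by
  let g : (i : Fin I) → (Fin (S.n i) → Bool) → ℝ := fun i b =>
    ∑ j, ((if b j = true then 1 else 0) * ((S.Y1 i j - θ * S.D1 i j) / S.p i j)
      - (1 - (if b j = true then 1 else 0)) * ((S.Y0 i j - θ * S.D0 i j) / (1 - S.p i j)))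
  have hg : S.setStat θ = fun i z => g i (z i) := by
    ext i z
    rw [setStat_eq]
    rfl
  rw [hg]
  exact iIndepFun.comp hind g fun i => measurable_of_countable _

lemma sum_variance_setStat (hind : S.IndependentSets) (hI : 1 ≤ I) (θ : ℝ) :
    ∑ i, Var[S.setStat θ i; S.post] = (I : ℝ) ^ 2 * Var[S.testStat θ; S.post] := by
  have hvar := IndepFun.variance_sum (s := Finset.univ) (fun i _ => S.memLp_post (S.setStat θ i) 2)
    (fun i _ j _ hij => (S.iIndepFun_setStat hind θ).indepFun hij)
  have hI' : (I : ℝ) ≠ 0 := by positivity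
  have : S.testStat θ = fun z => (1 / (I : ℝ)) * (∑ i, S.setStat θ i) z := by
    ext z
    simp [testStat]
  rw [this, variance_const_mul, hvar]
  field_simp

end MatchedIVStudy

theorem theorem2
    (S : (I : ℕ) → MatchedIVStudy I)
    (overlap : ∀ I : ℕ, (S I).Overlap)
    (independence : ∀ I : ℕ, (S I).IndependentSets)
    (ignorability : ∀ I : ℕ, (S I).Ignorability)
    (relevance : ∀ I : ℕ, 1 ≤ I → (S I).Relevance)
    (condition1 : ConvergentMeans S)
    (condition2 : NoExtremeVariances S)
    (condition3 : NonDegenerate S)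
    (condition4 : NoExtremeThirdMoments S)
    (condition5 : NoExtremeFourthMoments S)
    (α : ℝ) (hα : α ∈ Set.Ioo (0 : ℝ) (1 / 2)) :
    ENNReal.ofReal (1 - α) ≤
      liminf (fun I : ℕ =>
        (S I).post {z | (S I).effectRatio ∈ (S I).confidenceSet α z}) atTop := by
  have hα1 : α < 1 := hα.2.trans (by norm_num)
  obtain ⟨c, hc, hvar⟩ := condition3.liminf_pos
  have h4 : Tendsto (fun I : ℕ =>
      (∑ i, ∫ z, (S I).setStat (S I).effectRatio i z ^ 4 ∂(S I).post) / (I : ℝ) ^ 2)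
      atTop (𝓝 0) := by
    refine condition5.tendsto_div_nhds_zero.congr fun I => ?_
    rw [one_div_mul_eq_div, div_div, sq]
  refine (one_sub_le_gaussianReal_Icc hα.1).trans
    (gaussianReal_Icc_le_liminf_abs_div_sqrt_meanVarEst_le (fun I => (S I).post)
      (W := fun I => (S I).setStat (S I).effectRatio) (fun I i => (S I).memLp_post _ 4)
      (fun I => (S I).iIndepFun_setStat (independence I) _) ?_ hc ?_ condition4 h4
      (stdNormalQuantile_pos hα.1 hα1))
  · filter_upwards [eventually_ge_atTop 1] with I hI
    exact (S I).sum_integral_setStat_effectRatio (overlap I) (ignorability I) (relevance I hI)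
  · filter_upwards [hvar, eventually_ge_atTop 1] with I hcI hI
    rw [(S I).sum_variance_setStat (independence I) hI]
    have := mul_le_mul_of_nonneg_right hcI (Nat.cast_nonneg (α := ℝ) I)
    linarith
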